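/- Let $m$ be a natural number and let $G$ be an $m\times m$ matrix of rational functions of the complex variable $z$ with real coefficients (not assumed symmetric), which is proper (in every entry the degree of the numerator does not exceed the degree of the denominator) and has no pole at $z=1$ or $z=-1$ (a pole of $G$ is a pole of some entry). For a complex matrix $M$ let $M^*$ be its conjugate transpose, and write $\ge 0$, $\le 0$, $>0$ for positive semidefiniteness, negative semidefiniteness and positive definiteness of Hermitian matrices. $G$ is called *discrete negative imaginary* (D-NI) if $G$ is analytic in $\{|z|>1\}$ and, for all $z$ with $|z|>1$, $i[G(z)-G(z)^*]\ge 0$ if $\operatorname{Im} z>0$, $i[G(z)-G(z)^*]=0$ if $\operatorname{Im} z=0$, and $i[G(z)-G(z)^*]\le 0$ if $\operatorname{Im} z<0$. $G$ is called *discrete weakly strictly negative imaginary* (D-WSNI) if all its poles lie in $\{|z|<1\}$ and $i[G(e^{i\theta})-G(e^{i\theta})^*]>0$ for all $\theta\in(0,\pi)$. Then: 1. if $G$ is D-NI, then $G(1)-G(-1)$ is (Hermitian) positive semidefinite, $G(1)-G(-1)\ge 0$; 2. if $G$ is D-WSNI, then $G(1)-G(-1)$ is (Hermitian) positive definite, $G(1)-G(-1)>0$.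 -/

import Mathlib

open scoped ComplexOrder

noncomputable section

/-- An `m × m` real rational transfer function matrix: its entries are rational functions
(in the variable `z`) with real coefficients. -/
abbrev RealRationalTF (m : ℕ) := Matrix (Fin m) (Fin m) (RatFunc ℝ)

namespace RealRationalTF

variable {m : ℕ}

/-- `z` is a (finite) pole of `G`: it is a zero of the reduced denominator of some entry. -/
def IsPole (G : RealRationalTF m) (z : ℂ) : Prop :=
  ∃ i j, (G i j).denom.eval₂ (algebraMap ℝ ℂ) z = 0

/-- `G` is proper: no entry has a numerator of larger degree than its denominator, that is,
`G` has no pole at infinity. -/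
def IsProper (G : RealRationalTF m) : Prop :=
  ∀ i j, (G i j).intDegree ≤ 0

/-- The matrix-valued function `z ↦ G(z)` of a complex variable (meaningful off the poles). -/
def toFun (G : RealRationalTF m) (z : ℂ) : Matrix (Fin m) (Fin m) ℂ :=
  Matrix.of fun i j => (G i j).eval (algebraMap ℝ ℂ) z

end RealRationalTF

/-- The Hermitian matrix `i [M - M*]`. -/
def skewIm {m : ℕ} (M : Matrix (Fin m) (Fin m) ℂ) : Matrix (Fin m) (Fin m) ℂ :=
  Complex.I • (M - M.conjTranspose)

/-- Discrete negative imaginary (D-NI) functions: analytic in `|z| > 1`, and there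
`i [G(z) - G(z)*]` is `≥ 0`, `= 0`, `≤ 0` according to whether `Im z` is positive, zero, negative. -/
structure IsDNI {m : ℕ} (G : ℂ → Matrix (Fin m) (Fin m) ℂ) : Prop where
  analytic : ∀ i j, AnalyticOnNhd ℂ (fun z => G z i j) {z : ℂ | 1 < ‖z‖}
  upper : ∀ z : ℂ, 1 < ‖z‖ → 0 < z.im → (skewIm (G z)).PosSemidef
  real_axis : ∀ z : ℂ, 1 < ‖z‖ → z.im = 0 → skewIm (G z) = 0
  lower : ∀ z : ℂ, 1 < ‖z‖ → z.im < 0 → (-skewIm (G z)).PosSemidef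

/-- Discrete weakly strictly negative imaginary (D-WSNI) real rational proper transfer functions:
all poles lie in `|z| < 1`, and `i [G(e^{iθ}) - G(e^{iθ})*] > 0` for all `θ ∈ (0, π)`. -/
structure IsDWSNI {m : ℕ} (G : RealRationalTF m) : Prop where
  proper : G.IsProper
  poles : ∀ z : ℂ, G.IsPole z → ‖z‖ < 1
  circle : ∀ θ ∈ Set.Ioo (0 : ℝ) Real.pi,
    (skewIm (G.toFun (Complex.exp (θ * Complex.I)))).PosDef

end

/-! Substituting w = z⁻¹ turns |z| > 1 into the punctured unit disk, and the upper half plane into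
the lower one. As v* `skewIm M` v = -2 Im(v* M v), the D-NI condition says that h(w) = v* G(w⁻¹) v
has Im h ≤ 0 on the lower half disk and is real on the diameter. The Cauchy–Riemann equations then
give h' ≥ 0 on (-1, 1) (`monotoneOn_re_of_im_nonpos`), so h(-1) ≤ h(1). For D-WSNI the sign is known
only on the circle: h is symmetrised to be real on the diameter, the maximum principle carries the
sign inside, and the identity theorem makes the inequality strict
(`re_neg_one_lt_re_one_of_im_neg_on_arc`). In both cases G(±1) is real and a limit of matrices with
nonnegative skew part, which forces symmetry. -/

open Polynomial Filter Topology Matrix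

/-! ### Functions of one variable mapping the lower half disk to the lower half plane -/

/-- A function that is real on the real axis and maps the lower half disk to the lower half plane
is monotone along the real diameter. -/
theorem monotoneOn_re_of_im_nonpos {h : ℂ → ℂ}
    (hd : ∀ x : ℝ, x ∈ Set.Icc (-1 : ℝ) 1 → DifferentiableAt ℂ h x)
    (hreal : ∀ x : ℝ, x ∈ Set.Ioo (-1 : ℝ) 1 → (h x).im = 0)
    (hlow : ∀ w : ℂ, ‖w‖ < 1 → w.im < 0 → (h w).im ≤ 0) :
    MonotoneOn (fun x : ℝ => (h x).re) (Set.Icc (-1) 1) := by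
  have hder : ∀ x : ℝ, x ∈ Set.Icc (-1 : ℝ) 1 →
      HasDerivAt (fun x : ℝ => (h x).re) (deriv h x).re x := fun x hx =>
    (hd x hx).hasDerivAt.real_of_complex
  refine monotoneOn_of_deriv_nonneg (convex_Icc _ _)
    (fun x hx => (hder x hx).continuousAt.continuousWithinAt) ?_ ?_
  · intro x hx
    exact (hder x (interior_subset hx)).differentiableAt.differentiableWithinAt
  · intro x hx
    have hxI := interior_subset hx
    rw [interior_Icc] at hx
    rw [(hder x hxI).deriv]
    -- At t = 0 the function i h(x - it) has derivative h'(x). Its real part -Im h(x - it) vanishes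
    -- at t = 0 and is nonnegative for small t > 0, so the right slopes are nonnegative.
    have hline : HasDerivAt (fun s : ℂ => (x : ℂ) - s * Complex.I) (-Complex.I) ((0 : ℝ) : ℂ) := by
      simpa using ((hasDerivAt_id ((0 : ℝ) : ℂ)).mul_const Complex.I).const_sub (x : ℂ)
    have hcomp : HasDerivAt (fun s : ℂ => Complex.I * h ((x : ℂ) - s * Complex.I))
        (Complex.I * (deriv h x * (-Complex.I))) ((0 : ℝ) : ℂ) := by
      have h0 : HasDerivAt h (deriv h x) ((x : ℂ) - ((0 : ℝ) : ℂ) * Complex.I) := by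
        simpa using (hd x hxI).hasDerivAt
      exact (HasDerivAt.comp ((0 : ℝ) : ℂ) h0 hline).const_mul Complex.I
    have hslope := hcomp.real_of_complex.tendsto_slope_zero_right
    have hval : (Complex.I * (deriv h x * (-Complex.I))).re = (deriv h x).re := by simp
    rw [hval] at hslope
    refine ge_of_tendsto hslope ?_
    have hsmall : ∀ᶠ t : ℝ in 𝓝[>] 0, ‖(x : ℂ) - t * Complex.I‖ < 1 := by
      have hc : Continuous fun t : ℝ => ‖(x : ℂ) - t * Complex.I‖ := by fun_prop
      refine (hc.tendsto 0).eventually_lt_const ?_ |>.filter_mono nhdsWithin_le_nhds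
      simpa using abs_lt.2 hx
    filter_upwards [hsmall, self_mem_nhdsWithin] with t ht ht0
    have ht0' : 0 < t := ht0
    have hl := hlow _ ht (by simpa using ht0')
    have hr := hreal x hx
    simp only [zero_add, Complex.ofReal_zero, zero_mul, sub_zero, Complex.mul_re, Complex.I_re,
      Complex.I_im, one_mul, smul_eq_mul, zero_sub, hr]
    have : 0 ≤ t⁻¹ := by positivity
    nlinarith

/-- Maximum principle for the imaginary part on the lower half disk. -/
theorem im_nonpos_of_im_nonpos_on_arc {h : ℂ → ℂ}
    (hd : ∀ w : ℂ, ‖w‖ ≤ 1 → DifferentiableAt ℂ h w)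
    (hreal : ∀ w : ℂ, ‖w‖ ≤ 1 → w.im = 0 → (h w).im = 0)
    (harc : ∀ w : ℂ, ‖w‖ = 1 → w.im < 0 → (h w).im ≤ 0)
    {w : ℂ} (hw : ‖w‖ < 1) (hwim : w.im < 0) : (h w).im ≤ 0 := by
  set U : Set ℂ := {w | ‖w‖ < 1 ∧ w.im < 0} with hU
  have hopen : IsOpen U := by
    exact (isOpen_lt continuous_norm continuous_const).inter
      (isOpen_lt Complex.continuous_im continuous_const)
  have hclosure : closure U ⊆ {w | ‖w‖ ≤ 1 ∧ w.im ≤ 0} := by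
    refine closure_minimal (fun w hw => ⟨hw.1.le, hw.2.le⟩) ?_
    exact (isClosed_le continuous_norm continuous_const).inter
      (isClosed_le Complex.continuous_im continuous_const)
  have hbdd : Bornology.IsBounded U :=
    (Metric.isBounded_ball (x := (0 : ℂ)) (r := 1)).subset fun w hw => by simpa using hw.1
  -- |exp(-ih)| = exp(Im h) turns the bound on Im h into a bound on a modulus.
  have hnorm : ∀ w, ‖Complex.exp (-Complex.I * h w)‖ = Real.exp (h w).im := fun w => by
    simp [Complex.norm_exp]
  have hexp : ∀ w : ℂ, ‖w‖ ≤ 1 →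
      DifferentiableAt ℂ (fun w => Complex.exp (-Complex.I * h w)) w := fun w hw =>
    ((hd w hw).const_mul _).cexp
  have hdiff : DiffContOnCl ℂ (fun w => Complex.exp (-Complex.I * h w)) U :=
    ⟨fun w hw => (hexp w hw.1.le).differentiableWithinAt,
      fun w hw => (hexp w (hclosure hw).1).continuousAt.continuousWithinAt⟩
  have hmax := Complex.norm_le_of_forall_mem_frontier_norm_le hbdd hdiff (C := 1) (fun z hz => by
    rw [hnorm, Real.exp_le_one_iff]
    rw [hopen.frontier_eq] at hz
    obtain ⟨hz1, hz2⟩ := hclosure hz.1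
    rcases hz2.lt_or_eq with hlt | heq
    · refine harc z (hz1.antisymm (not_lt.1 fun hlt1 => hz.2 ⟨hlt1, hlt⟩)) hlt
    · exact (hreal z hz1 heq).le) (subset_closure (show w ∈ U from ⟨hw, hwim⟩))
  rwa [hnorm, Real.exp_le_one_iff] at hmax

/-- Strict increase along the real diameter when the imaginary part is negative on the lower
unit semicircle. -/
theorem re_neg_one_lt_re_one_of_im_neg_on_arc {h : ℂ → ℂ}
    (ha : ∀ w : ℂ, ‖w‖ ≤ 1 → AnalyticAt ℂ h w)
    (hreal : ∀ w : ℂ, ‖w‖ ≤ 1 → w.im = 0 → (h w).im = 0)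
    (harc : ∀ w : ℂ, ‖w‖ = 1 → w.im < 0 → (h w).im < 0) :
    (h (-1)).re < (h 1).re := by
  have hnorm : ∀ x : ℝ, x ∈ Set.Icc (-1 : ℝ) 1 → ‖(x : ℂ)‖ ≤ 1 := fun x hx => by
    simpa using abs_le.2 hx
  have hmono : MonotoneOn (fun x : ℝ => (h x).re) (Set.Icc (-1) 1) := by
    refine monotoneOn_re_of_im_nonpos (fun x hx => (ha _ (hnorm x hx)).differentiableAt)
      (fun x hx => hreal _ (hnorm x (Set.Ioo_subset_Icc_self hx)) (by simp)) ?_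
    intro w hw hwim
    exact im_nonpos_of_im_nonpos_on_arc (fun w hw => (ha w hw).differentiableAt) hreal
      (fun w hw hwim => (harc w hw hwim).le) hw hwim
  have hle := hmono (show (-1 : ℝ) ∈ Set.Icc (-1 : ℝ) 1 by simp)
    (show (1 : ℝ) ∈ Set.Icc (-1 : ℝ) 1 by simp) (by norm_num)
  refine lt_of_le_of_ne (by simpa using hle) fun heq => ?_
  -- Monotone with equal end values, hence constant on the diameter; the identity theorem spreads
  -- this to -i, where Im h < 0.
  have hconst : ∀ x : ℝ, x ∈ Set.Icc (-1 : ℝ) 1 → h x = h 1 := fun x hx => by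
    have h1 := hmono (show (-1 : ℝ) ∈ Set.Icc (-1 : ℝ) 1 by simp) hx hx.1
    have h2 := hmono hx (show (1 : ℝ) ∈ Set.Icc (-1 : ℝ) 1 by simp) hx.2
    simp only [Complex.ofReal_neg, Complex.ofReal_one] at h1 h2
    refine Complex.ext (by linarith) ?_
    rw [hreal _ (hnorm x hx) (by simp), hreal 1 (by simp) (by simp)]
  have hfreq : ∃ᶠ z in 𝓝[≠] (0 : ℂ), h z = (fun _ => h 1) z := by
    have htend : Tendsto (fun t : ℝ => (t : ℂ)) (𝓝[>] 0) (𝓝[≠] 0) := by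
      refine tendsto_nhdsWithin_iff.2 ⟨?_, ?_⟩
      · exact (Complex.continuous_ofReal.tendsto' 0 0 (by simp)).mono_left nhdsWithin_le_nhds
      · filter_upwards [self_mem_nhdsWithin] with t ht
        have ht' : (0 : ℝ) < t := ht
        simpa using ht'.ne'
    refine htend.frequently (Eventually.frequently ?_)
    filter_upwards [Ioo_mem_nhdsGT (zero_lt_one (α := ℝ))] with t ht
    exact hconst t ⟨by linarith [ht.1], ht.2.le⟩
  have hball : AnalyticOnNhd ℂ h (Metric.closedBall 0 1) := fun w hw => ha w (by simpa using hw)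
  have heqOn := hball.eqOn_of_preconnected_of_frequently_eq analyticOnNhd_const
    (convex_closedBall (0 : ℂ) 1).isPreconnected (by simp) hfreq
  have hI : h (-Complex.I) = h 1 := heqOn (by simp)
  have := harc (-Complex.I) (by simp) (by simp)
  rw [hI, hreal 1 (by simp) (by simp)] at this
  exact lt_irrefl _ this

/-! ### The skew part of a matrix -/

section SkewPart

variable {m : ℕ}

theorem star_dotProduct_conjTranspose_mulVec (M : Matrix (Fin m) (Fin m) ℂ) (v : Fin m → ℂ) :
    star v ⬝ᵥ (Mᴴ *ᵥ v) = star (star v ⬝ᵥ (M *ᵥ v)) := by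
  rw [← star_dotProduct, star_mulVec, ← dotProduct_mulVec]

theorem star_dotProduct_skewIm_mulVec (M : Matrix (Fin m) (Fin m) ℂ) (v : Fin m → ℂ) :
    star v ⬝ᵥ (skewIm M *ᵥ v) = ((-2 * (star v ⬝ᵥ (M *ᵥ v)).im : ℝ) : ℂ) := by
  rw [skewIm, smul_mulVec, sub_mulVec, dotProduct_smul, dotProduct_sub,
    star_dotProduct_conjTranspose_mulVec]
  apply Complex.ext
  · simp; ring
  · simp

theorem isHermitian_skewIm (M : Matrix (Fin m) (Fin m) ℂ) : (skewIm M).IsHermitian := by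
  ext i j
  simp [skewIm]
  ring

theorem im_nonpos_of_posSemidef_skewIm {M : Matrix (Fin m) (Fin m) ℂ}
    (hM : (skewIm M).PosSemidef) (v : Fin m → ℂ) : (star v ⬝ᵥ (M *ᵥ v)).im ≤ 0 := by
  have := hM.dotProduct_mulVec_nonneg v
  rw [star_dotProduct_skewIm_mulVec, Complex.zero_le_real] at this
  linarith

theorem im_neg_of_posDef_skewIm {M : Matrix (Fin m) (Fin m) ℂ}
    (hM : (skewIm M).PosDef) {v : Fin m → ℂ} (hv : v ≠ 0) : (star v ⬝ᵥ (M *ᵥ v)).im < 0 := by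
  have := hM.dotProduct_mulVec_pos hv
  rw [star_dotProduct_skewIm_mulVec, Complex.zero_lt_real] at this
  linarith

/-- A real matrix whose skew part is positive semidefinite is symmetric. -/
theorem isHermitian_of_posSemidef_skewIm {M : Matrix (Fin m) (Fin m) ℂ}
    (hreal : ∀ i j, (M i j).im = 0) (hM : (skewIm M).PosSemidef) : M.IsHermitian := by
  -- The diagonal of M is real, so it cancels in M - M*; a positive semidefinite matrix of trace
  -- zero is zero.
  have htrace : (skewIm M).trace = 0 := by
    refine Finset.sum_eq_zero fun i _ => ?_
    simp [skewIm, Matrix.diag, sub_eq_zero, Complex.ext_iff, hreal]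
  have h0 := hM.trace_eq_zero_iff.1 htrace
  rw [skewIm, smul_eq_zero_iff_right Complex.I_ne_zero, sub_eq_zero] at h0
  exact h0.symm

/-- Positive semidefiniteness of the skew part passes to limits. -/
theorem posSemidef_skewIm_of_tendsto {ι : Type*} {l : Filter ι} [l.NeBot]
    {F : ι → Matrix (Fin m) (Fin m) ℂ} {M : Matrix (Fin m) (Fin m) ℂ}
    (hF : Tendsto F l (𝓝 M)) (hpos : ∀ᶠ t in l, (skewIm (F t)).PosSemidef) :
    (skewIm M).PosSemidef := by
  refine .of_dotProduct_mulVec_nonneg (isHermitian_skewIm M) fun v => ?_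
  rw [star_dotProduct_skewIm_mulVec, Complex.zero_le_real]
  have hc : Continuous fun A : Matrix (Fin m) (Fin m) ℂ => (star v ⬝ᵥ (A *ᵥ v)).im := by fun_prop
  have := le_of_tendsto ((hc.tendsto M).comp hF)
    (hpos.mono fun t ht => im_nonpos_of_posSemidef_skewIm ht v)
  linarith

theorem analyticAt_star_dotProduct_mulVec {H : ℂ → Matrix (Fin m) (Fin m) ℂ} {w : ℂ}
    (hH : ∀ i j, AnalyticAt ℂ (fun w => H w i j) w) (u v : Fin m → ℂ) :
    AnalyticAt ℂ (fun w => u ⬝ᵥ (H w *ᵥ v)) w := by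
  simp only [dotProduct, mulVec]
  refine Finset.analyticAt_fun_sum _ fun i _ => analyticAt_const.mul ?_
  exact Finset.analyticAt_fun_sum _ fun j _ => (hH i j).mul analyticAt_const

theorem continuousAt_of_analyticAt_entries {H : ℂ → Matrix (Fin m) (Fin m) ℂ} {w : ℂ}
    (hH : ∀ i j, AnalyticAt ℂ (fun w => H w i j) w) : ContinuousAt H w :=
  continuousAt_pi.2 fun i => continuousAt_pi.2 fun j => (hH i j).continuousAt

end SkewPart

/-! ### The transfer function in the variable `w = z⁻¹` -/

namespace RealRationalTF

variable {m : ℕ} (G : RealRationalTF m)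

/-- The function `w ↦ G (w⁻¹)`, extended to `w = 0` when `G` is proper. -/
noncomputable def invFun (w : ℂ) : Matrix (Fin m) (Fin m) ℂ :=
  Matrix.of fun i j =>
    ((G i j).num.reflect (G i j).denom.natDegree).eval₂ (algebraMap ℝ ℂ) w /
      ((G i j).denom.reflect (G i j).denom.natDegree).eval₂ (algebraMap ℝ ℂ) w

variable {G}

theorem IsProper.natDegree_num_le (hG : G.IsProper) (i j : Fin m) :
    (G i j).num.natDegree ≤ (G i j).denom.natDegree := by
  have := hG i j
  rw [RatFunc.intDegree] at this
  omega

/-- Both reflections use the degree d of the denominator, so numerator and denominator gain the same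
factor w^d; properness makes d large enough for the numerator. -/
theorem invFun_eq (hG : G.IsProper) {w : ℂ} (hw : w ≠ 0) : G.invFun w = G.toFun w⁻¹ := by
  ext i j
  let _ : Invertible w⁻¹ := invertibleOfNonzero (inv_ne_zero hw)
  have hinv : ⅟(w⁻¹) = w := by rw [invOf_eq_inv, inv_inv]
  have hn := eval₂_reflect_mul_pow (algebraMap ℝ ℂ) w⁻¹ _ _ (hG.natDegree_num_le i j)
  have hd := eval₂_reflect_mul_pow (algebraMap ℝ ℂ) w⁻¹ _ (G i j).denom le_rfl
  rw [hinv] at hn hd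
  simp only [invFun, toFun, Matrix.of_apply, RatFunc.eval]
  rw [← hn, ← hd, mul_div_mul_right _ _ (pow_ne_zero _ (inv_ne_zero hw))]

theorem analyticAt_invFun {w : ℂ} (hw : w ≠ 0 → ¬ G.IsPole w⁻¹) (i j : Fin m) :
    AnalyticAt ℂ (fun w => G.invFun w i j) w := by
  have hpoly : ∀ p : ℝ[X], AnalyticAt ℂ (fun w : ℂ => p.eval₂ (algebraMap ℝ ℂ) w) w := fun p => by
    simpa only [eval₂_eq_eval_map] using (p.map (algebraMap ℝ ℂ)).differentiable.analyticAt w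
  refine (hpoly _).div (hpoly _) ?_
  by_cases h0 : w = 0
  · subst h0
    -- At 0 the reflected denominator takes the leading coefficient of the denominator.
    rw [eval₂_at_zero, coeff_reflect, revAt_le (Nat.zero_le _)]
    simp [RatFunc.denom_ne_zero]
  · intro h
    refine hw h0 ⟨i, j, ?_⟩
    let _ : Invertible w⁻¹ := invertibleOfNonzero (inv_ne_zero h0)
    rw [← eval₂_reflect_eq_zero_iff (algebraMap ℝ ℂ) w⁻¹ _ _ le_rfl, invOf_eq_inv, inv_inv]
    exact h

theorem im_invFun_of_im_eq_zero {w : ℂ} (hw : w.im = 0) (i j : Fin m) :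
    (G.invFun w i j).im = 0 := by
  obtain ⟨x, rfl⟩ : ∃ x : ℝ, (x : ℂ) = w := ⟨w.re, Complex.ext rfl (by simpa using hw.symm)⟩
  have hpoly : ∀ p : ℝ[X], p.eval₂ (algebraMap ℝ ℂ) (x : ℂ) = ((p.eval x : ℝ) : ℂ) := fun p =>
    eval₂_at_apply (algebraMap ℝ ℂ) x
  simp only [invFun, Matrix.of_apply, hpoly, ← Complex.ofReal_div, Complex.ofReal_im]

theorem invFun_one (hG : G.IsProper) : G.invFun 1 = G.toFun 1 := by
  simpa using invFun_eq hG one_ne_zero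

theorem invFun_neg_one (hG : G.IsProper) : G.invFun (-1) = G.toFun (-1) := by
  have := invFun_eq hG (neg_ne_zero.2 one_ne_zero)
  rwa [inv_neg, inv_one] at this

theorem posSemidef_of_isDNI (hG : G.IsProper) (h1 : ¬ G.IsPole 1) (hm1 : ¬ G.IsPole (-1))
    (hD : IsDNI G.toFun) : (G.toFun 1 - G.toFun (-1)).PosSemidef := by
  have one_lt : ∀ w : ℂ, w ≠ 0 → ‖w‖ < 1 → 1 < ‖w⁻¹‖ := fun w h0 hw => by
    rw [norm_inv]
    exact (one_lt_inv₀ (norm_pos_iff.2 h0)).2 hw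
  have ha : ∀ x : ℝ, x ∈ Set.Icc (-1 : ℝ) 1 → ∀ i j,
      AnalyticAt ℂ (fun w => G.invFun w i j) (x : ℂ) := fun x hx i j => by
    rcases hx.1.eq_or_lt with rfl | hx1
    · exact analyticAt_invFun (fun _ => by simpa using hm1) i j
    rcases hx.2.eq_or_lt with rfl | hx2
    · exact analyticAt_invFun (fun _ => by simpa using h1) i j
    by_cases h0 : (x : ℂ) = 0
    · exact analyticAt_invFun (fun h => absurd h0 h) i j
    have hlt : 1 < ‖(x : ℂ)⁻¹‖ := one_lt _ h0 (by simpa using abs_lt.2 ⟨hx1, hx2⟩)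
    -- D-NI asserts analyticity of the evaluated function, not absence of poles, so it is
    -- transported through inversion.
    refine ((hD.analytic i j _ hlt).comp (analyticAt_inv h0)).congr ?_
    filter_upwards [eventually_ne_nhds h0] with w hw
    simp [invFun_eq hG hw]
  have hskew : ∀ x : ℝ, x ≠ 0 → x ∈ Set.Ioo (-1 : ℝ) 1 → skewIm (G.invFun x) = 0 := fun x h0 hx => by
    have h0' : (x : ℂ) ≠ 0 := by simpa using h0
    rw [invFun_eq hG h0']
    refine hD.real_axis _ (one_lt _ h0' (by simpa using abs_lt.2 hx)) ?_
    rw [← Complex.ofReal_inv, Complex.ofReal_im]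
  have hherm : ∀ p : ℝ, |p| = 1 → (G.invFun p).IsHermitian := fun p hp => by
    have hp' : p ∈ Set.Icc (-1 : ℝ) 1 := abs_le.1 hp.le
    refine isHermitian_of_posSemidef_skewIm (im_invFun_of_im_eq_zero (by simp)) ?_
    -- This path reaches p along the diameter and, for 0 < t < 1, avoids w = 0, which corresponds to
    -- no finite z.
    have hline : Tendsto (fun t : ℝ => (((1 - t) * p : ℝ) : ℂ)) (𝓝[>] 0) (𝓝 (p : ℂ)) := by
      have hc : Continuous fun t : ℝ => (((1 - t) * p : ℝ) : ℂ) := by fun_prop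
      exact (hc.tendsto' 0 _ (by simp)).mono_left nhdsWithin_le_nhds
    refine posSemidef_skewIm_of_tendsto
      ((continuousAt_of_analyticAt_entries (ha p hp')).tendsto.comp hline) ?_
    filter_upwards [Ioo_mem_nhdsGT (zero_lt_one (α := ℝ))] with t ht
    have hp0 : p ≠ 0 := fun h => by simp [h] at hp
    have habs : |(1 - t) * p| < 1 := by
      rw [abs_mul, hp, mul_one, abs_lt]
      constructor <;> linarith [ht.1, ht.2]
    rw [Function.comp_apply, hskew _ (mul_ne_zero (by linarith [ht.2]) hp0) (abs_lt.1 habs)]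
    exact .zero
  have hH : (G.toFun 1 - G.toFun (-1)).IsHermitian := by
    have e1 := hherm 1 (by simp)
    have e2 := hherm (-1) (by simp)
    simp only [Complex.ofReal_neg, Complex.ofReal_one] at e1 e2
    rw [invFun_one hG] at e1
    rw [invFun_neg_one hG] at e2
    exact e1.sub e2
  refine .of_dotProduct_mulVec_nonneg hH fun v => ?_
  have him : ∀ x : ℝ, x ≠ 0 → x ∈ Set.Ioo (-1 : ℝ) 1 →
      (star v ⬝ᵥ (G.invFun x *ᵥ v)).im = 0 := fun x h0 hx => by
    have hq := star_dotProduct_skewIm_mulVec (G.invFun x) v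
    rw [hskew x h0 hx, zero_mulVec, dotProduct_zero, eq_comm, Complex.ofReal_eq_zero] at hq
    linarith
  have hmono := monotoneOn_re_of_im_nonpos (h := fun w => star v ⬝ᵥ (G.invFun w *ᵥ v))
    (fun x hx => (analyticAt_star_dotProduct_mulVec (ha x hx) _ _).differentiableAt) ?_ ?_
  · have hle := hmono (show (-1 : ℝ) ∈ Set.Icc (-1 : ℝ) 1 by simp)
      (show (1 : ℝ) ∈ Set.Icc (-1 : ℝ) 1 by simp) (by norm_num)
    simp only [Complex.ofReal_neg, Complex.ofReal_one, invFun_one hG, invFun_neg_one hG] at hle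
    rw [Complex.nonneg_iff]
    refine ⟨?_, (hH.im_star_dotProduct_mulVec_self v).symm⟩
    rw [sub_mulVec, dotProduct_sub, Complex.sub_re]
    linarith
  · intro x hx
    -- The point w = 0 is z = ∞; reality there follows by continuity.
    by_cases h0 : x = 0
    · subst h0
      have hc : Tendsto (fun t : ℝ => (star v ⬝ᵥ (G.invFun t *ᵥ v)).im) (𝓝[≠] 0)
          (𝓝 (star v ⬝ᵥ (G.invFun (0 : ℝ) *ᵥ v)).im) := by
        have hq := (analyticAt_star_dotProduct_mulVec (ha 0 (by simp)) (star v) v).continuousAt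
        have hcomp := hq.tendsto.comp (Complex.continuous_ofReal.tendsto 0)
        exact ((Complex.continuous_im.tendsto _).comp hcomp).mono_left nhdsWithin_le_nhds
      refine tendsto_nhds_unique (hc.congr' ?_) tendsto_const_nhds
      filter_upwards [self_mem_nhdsWithin, nhdsWithin_le_nhds (Ioo_mem_nhds hx.1 hx.2)] with t h0 ht
      exact him t h0 ht
    · exact him x h0 hx
  · intro w hw hwim
    have h0 : w ≠ 0 := fun h => by simp [h] at hwim
    have hz : 0 < (w⁻¹).im := by
      rw [Complex.inv_im]
      exact div_pos (by linarith) (Complex.normSq_pos.2 h0)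
    simp only [invFun_eq hG h0]
    exact im_nonpos_of_posSemidef_skewIm (hD.upper _ (one_lt _ h0 hw) hz) v

theorem posDef_of_isDWSNI (hG : G.IsProper) (hD : IsDWSNI G) : (G.toFun 1 - G.toFun (-1)).PosDef := by
  have ha : ∀ w : ℂ, ‖w‖ ≤ 1 → ∀ i j, AnalyticAt ℂ (fun w => G.invFun w i j) w := by
    intro w hw i j
    refine analyticAt_invFun (fun h0 hp => ?_) i j
    have := hD.poles _ hp
    rw [norm_inv] at this
    exact absurd hw (not_le.2 ((inv_lt_one₀ (norm_pos_iff.2 h0)).1 this))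
  have harc : ∀ w : ℂ, ‖w‖ = 1 → w.im < 0 → (skewIm (G.invFun w)).PosDef := by
    intro w hw hwim
    have h0 : w ≠ 0 := fun h => by simp [h] at hwim
    have hz : 0 < (w⁻¹).im := by
      rw [Complex.inv_im]
      exact div_pos (by linarith) (Complex.normSq_pos.2 h0)
    have hexp : Complex.exp ((w⁻¹).arg * Complex.I) = w⁻¹ := by
      simpa [hw] using Complex.norm_mul_exp_arg_mul_I w⁻¹
    rw [invFun_eq hG h0, ← hexp]
    refine hD.circle _ ⟨?_, ?_⟩
    · refine lt_of_le_of_ne (Complex.arg_nonneg_iff.2 hz.le) fun h => ?_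
      exact hz.ne' (Complex.arg_eq_zero_iff.1 h.symm).2
    · exact Complex.arg_lt_pi_iff.2 (.inr hz.ne')
  have hherm : ∀ p : ℝ, |p| = 1 → (G.invFun p).IsHermitian := fun p hp => by
    refine isHermitian_of_posSemidef_skewIm (im_invFun_of_im_eq_zero (by simp)) ?_
    -- The factor p in the exponent keeps the path on the lower arc for both p = 1 and p = -1: its
    -- imaginary part is -sin t.
    have hc : Continuous fun t : ℝ => (p : ℂ) * Complex.exp (-(p * t) * Complex.I) := by fun_prop
    have hline := (hc.tendsto' 0 (p : ℂ) (by simp)).mono_left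
      (nhdsWithin_le_nhds (s := Set.Ioi 0))
    refine posSemidef_skewIm_of_tendsto
      ((continuousAt_of_analyticAt_entries (ha p (by simp [hp]))).tendsto.comp hline) ?_
    filter_upwards [Ioo_mem_nhdsGT Real.pi_pos] with t ht
    have hcast : -((p : ℂ) * t) * Complex.I = ((-(p * t) : ℝ) : ℂ) * Complex.I := by push_cast; ring
    rw [Function.comp_apply, hcast]
    refine (harc _ ?_ ?_).posSemidef
    · rw [norm_mul, Complex.norm_exp_ofReal_mul_I, mul_one, Complex.norm_real, Real.norm_eq_abs, hp]
    · rw [Complex.im_ofReal_mul, Complex.exp_ofReal_mul_I_im]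
      have hsin := Real.sin_pos_of_mem_Ioo ht
      rcases eq_or_eq_neg_of_abs_eq hp with rfl | rfl <;> simpa using hsin
  have hS : (G.toFun 1).IsHermitian ∧ (G.toFun (-1)).IsHermitian := by
    have e1 := hherm 1 (by simp)
    have e2 := hherm (-1) (by simp)
    simp only [Complex.ofReal_neg, Complex.ofReal_one] at e1 e2
    rw [invFun_one hG] at e1
    rw [invFun_neg_one hG] at e2
    exact ⟨e1, e2⟩
  have hH := hS.1.sub hS.2
  refine .of_dotProduct_mulVec_pos hH fun v hv => ?_
  -- G need not be symmetric, so v* G(w⁻¹) v need not be real on the diameter. Adding the form at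
  -- the conjugate vector repairs this, and both terms have negative imaginary part on the lower
  -- arc.
  have hreal : ∀ w : ℂ, w.im = 0 →
      v ⬝ᵥ (G.invFun w *ᵥ star v) = star (star v ⬝ᵥ (G.invFun w *ᵥ v)) := by
    intro w hw
    have hmap : G.invFun w = (G.invFun w).map star := by
      ext i j
      exact (Complex.conj_eq_iff_im.2 (im_invFun_of_im_eq_zero hw i j)).symm
    simp only [dotProduct, mulVec, star_sum, star_mul', Pi.star_apply, star_star]
    refine Finset.sum_congr rfl fun i _ => congrArg _ (Finset.sum_congr rfl fun j _ => ?_)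
    congr 1
    exact congrFun (congrFun hmap i) j
  have hlt := re_neg_one_lt_re_one_of_im_neg_on_arc
    (h := fun w => star v ⬝ᵥ (G.invFun w *ᵥ v) + v ⬝ᵥ (G.invFun w *ᵥ star v))
    (fun w hw => (analyticAt_star_dotProduct_mulVec (ha w hw) _ _).add
      (analyticAt_star_dotProduct_mulVec (ha w hw) _ _))
    (fun w _ hw => by simp [hreal w hw])
    (fun w hw hwim => by
      have e1 := im_neg_of_posDef_skewIm (harc w hw hwim) hv
      have e2 := im_neg_of_posDef_skewIm (harc w hw hwim) (star_ne_zero.2 hv)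
      rw [star_star] at e2
      simpa using add_neg e1 e2)
  have e1 := hreal 1 (by simp)
  have e2 := hreal (-1) (by simp)
  simp only [e1, e2, Complex.add_re, Complex.star_def, Complex.conj_re] at hlt
  rw [invFun_one hG, invFun_neg_one hG] at hlt
  rw [Complex.pos_iff]
  refine ⟨?_, (hH.im_star_dotProduct_mulVec_self v).symm⟩
  rw [sub_mulVec, dotProduct_sub, Complex.sub_re]
  linarith

end RealRationalTF

theorem mainTheorem11 (m : ℕ) (G : RealRationalTF m) (hG : G.IsProper)
    (h1 : ¬ G.IsPole 1) (hm1 : ¬ G.IsPole (-1)) :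
    (IsDNI G.toFun → (G.toFun 1 - G.toFun (-1)).PosSemidef) ∧
      (IsDWSNI G → (G.toFun 1 - G.toFun (-1)).PosDef) :=
  ⟨RealRationalTF.posSemidef_of_isDNI hG h1 hm1, RealRationalTF.posDef_of_isDWSNI hG⟩
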